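/- Let $\mathbb H$ be the real quaternion algebra and let $r(M)$ denote the rank of a quaternion matrix $M$ (the dimension of its column space as a right $\mathbb H$-vector space). Let $k\ge 1$ and let $A_i,B_i,C_i,D_i,E_i$ $(i=1,\dots,k)$ be quaternion matrices of compatible sizes. The system of $k$ equations in the $k+1$ unknown quaternion matrices $X_1,\dots,X_{k+1}$ $$A_iX_iB_i+C_iX_{i+1}D_i=E_i,\qquad i=1,\dots,k,$$ has a solution if and only if the following $2k(k+1)$ rank equalities hold for all $i=1,\dots,k$ and all $1\le m<n\le k$ (blank entries are zero): $$r\begin{pmatrix}A_i&E_i&C_i\end{pmatrix}=r\begin{pmatrix}A_i&C_i\end{pmatrix},\qquad r\begin{pmatrix}B_i\\E_i\\D_i\end{pmatrix}=r\begin{pmatrix}B_i\\D_i\end{pmatrix},$$ $$r\begin{pmatrix}A_i&E_i\\0&D_i\end{pmatrix}=r(A_i)+r(D_i),\qquad r\begin{pmatrix}B_i&0\\E_i&C_i\end{pmatrix}=r(B_i)+r(C_i),$$ $$r\begin{pmatrix}A_m&E_m&C_m\\&D_m&&B_{m+1}\\&&A_{m+1}&-E_{m+1}&C_{m+1}\\&&&\ddots&\ddots&\ddots\\&&&&A_n&(-1)^{n-m}E_n&C_n\end{pmatrix}=r\begin{pmatrix}A_m&C_m\\&A_{m+1}&C_{m+1}\\&&\ddots&\ddots\\&&&A_n&C_n\end{pmatrix}+r\begin{pmatrix}D_m&B_{m+1}\\&D_{m+1}&B_{m+2}\\&&\ddots&\ddots\\&&&D_{n-1}&B_n\end{pmatrix},$$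 $$r\begin{pmatrix}B_m\\E_m&C_m\\D_m&&B_{m+1}\\&A_{m+1}&-E_{m+1}&\ddots\\&&D_{m+1}&\ddots&B_n\\&&&\ddots&(-1)^{n-m}E_n\\&&&&D_n\end{pmatrix}=r\begin{pmatrix}C_m\\A_{m+1}&C_{m+1}\\&A_{m+2}&\ddots\\&&\ddots&C_{n-1}\\&&&A_n\end{pmatrix}+r\begin{pmatrix}B_m\\D_m&B_{m+1}\\&D_{m+1}&\ddots\\&&\ddots&B_n\\&&&D_n\end{pmatrix},$$ $$r\begin{pmatrix}A_m&E_m&C_m\\&D_m&&B_{m+1}\\&&A_{m+1}&-E_{m+1}&\ddots\\&&&D_{m+1}&\ddots&B_n\\&&&&\ddots&(-1)^{n-m}E_n\\&&&&&D_n\end{pmatrix}=r\begin{pmatrix}A_m&C_m\\&A_{m+1}&C_{m+1}\\&&\ddots&\ddots\\&&&A_{n-1}&C_{n-1}\\&&&&A_n\end{pmatrix}+r\begin{pmatrix}D_m&B_{m+1}\\&D_{m+1}&B_{m+2}\\&&\ddots&\ddots\\&&&D_{n-1}&B_n\\&&&&D_n\end{pmatrix},$$ $$r\begin{pmatrix}B_m\\E_m&C_m\\D_m&&B_{m+1}\\&A_{m+1}&-E_{m+1}&C_{m+1}\\&&\ddots&\ddots&\ddots\\&&&A_n&(-1)^{n-m}E_n&C_n\end{pmatrix}=r\begin{pmatrix}C_m\\A_{m+1}&C_{m+1}\\&A_{m+2}&C_{m+2}\\&&\ddots&\ddots\\&&&A_n&C_n\end{pmatrix}+r\begin{pmatrix}B_m\\D_m&B_{m+1}\\&D_{m+1}&B_{m+2}\\&&\ddots&\ddots\\&&&D_{n-1}&B_n\end{pmatrix}.$$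 -/

import Mathlib

open scoped Quaternion

namespace Sylvester

/-- The rank of a quaternion matrix: the dimension of its column space as a right vector space
over the quaternions, i.e. the maximal number of right linearly independent columns.  (Right
scalar multiplication is the action of the opposite ring; the left span of the columns would not
give the rank over a noncommutative division ring.) -/
noncomputable def rank {r c : Type*} (M : Matrix r c ℍ[ℝ]) : ℕ :=
  Module.finrank (ℍ[ℝ])ᵐᵒᵖ (Submodule.span (ℍ[ℝ])ᵐᵒᵖ (Set.range M.col))

/-! Sizes.  The equations are indexed by `i : Fin k` and the unknowns by `j : Fin (k + 1)`;
equation `i` involves the unknowns `i.castSucc` and `i.succ`.  The unknown `X j` is `a j × b j`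
and `E i` is `p i × q i`.  Sizes may be zero. -/

/-- The family `X` solves the system `A i * X i * B i + C i * X (i + 1) * D i = E i`. -/
def IsSolution {k : ℕ} {p q : Fin k → ℕ} {a b : Fin (k + 1) → ℕ}
    (A : ∀ i : Fin k, Matrix (Fin (p i)) (Fin (a i.castSucc)) ℍ[ℝ])
    (B : ∀ i : Fin k, Matrix (Fin (b i.castSucc)) (Fin (q i)) ℍ[ℝ])
    (C : ∀ i : Fin k, Matrix (Fin (p i)) (Fin (a i.succ)) ℍ[ℝ])
    (D : ∀ i : Fin k, Matrix (Fin (b i.succ)) (Fin (q i)) ℍ[ℝ])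
    (E : ∀ i : Fin k, Matrix (Fin (p i)) (Fin (q i)) ℍ[ℝ])
    (X : ∀ j : Fin (k + 1), Matrix (Fin (a j)) (Fin (b j)) ℍ[ℝ]) : Prop :=
  ∀ i : Fin k, A i * X i.castSucc * B i + C i * X i.succ * D i = E i

/-- The block bidiagonal matrix with one block row for each equation `i ∈ [m, n]` and one block
column for each `j ∈ S`: block row `i` has `A i` in block column `i.castSucc`, `C i` in block
column `i.succ`, and zeros elsewhere. -/
noncomputable def chainAC {k : ℕ} {p : Fin k → ℕ} {a : Fin (k + 1) → ℕ}
    (A : ∀ i : Fin k, Matrix (Fin (p i)) (Fin (a i.castSucc)) ℍ[ℝ])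
    (C : ∀ i : Fin k, Matrix (Fin (p i)) (Fin (a i.succ)) ℍ[ℝ])
    (m n : Fin k) (S : Set (Fin (k + 1))) :
    Matrix (Σ i : Set.Icc m n, Fin (p i)) (Σ j : S, Fin (a j)) ℍ[ℝ] :=
  Matrix.of fun x y =>
    if h : (y.1 : Fin (k + 1)) = (x.1 : Fin k).castSucc then
      A x.1 x.2 (Fin.cast (congrArg a h) y.2)
    else if h : (y.1 : Fin (k + 1)) = (x.1 : Fin k).succ then
      C x.1 x.2 (Fin.cast (congrArg a h) y.2)
    else 0

/-- The block bidiagonal matrix with one block column for each equation `i ∈ [m, n]` and one block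
row for each `j ∈ T`: block column `i` has `B i` in block row `i.castSucc`, `D i` in block row
`i.succ`, and zeros elsewhere. -/
noncomputable def chainBD {k : ℕ} {q : Fin k → ℕ} {b : Fin (k + 1) → ℕ}
    (B : ∀ i : Fin k, Matrix (Fin (b i.castSucc)) (Fin (q i)) ℍ[ℝ])
    (D : ∀ i : Fin k, Matrix (Fin (b i.succ)) (Fin (q i)) ℍ[ℝ])
    (m n : Fin k) (T : Set (Fin (k + 1))) :
    Matrix (Σ j : T, Fin (b j)) (Σ i : Set.Icc m n, Fin (q i)) ℍ[ℝ] :=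
  Matrix.of fun y x =>
    if h : (y.1 : Fin (k + 1)) = (x.1 : Fin k).castSucc then
      B x.1 (Fin.cast (congrArg b h) y.2) x.2
    else if h : (y.1 : Fin (k + 1)) = (x.1 : Fin k).succ then
      D x.1 (Fin.cast (congrArg b h) y.2) x.2
    else 0

/-- The large staircase matrix: its block rows are the rows of `chainAC` (equations `i ∈ [m, n]`)
and of `chainBD` (indices `j ∈ T`), its block columns are the columns of `chainBD` (equations
`i ∈ [m, n]`) and of `chainAC` (indices `j ∈ S`).  Equation `i` contributes the block
`(-1) ^ (i - m) • E i`.  The row and column index types carry no order, so listing the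
block rows and block columns alternately, as in the usual staircase picture

`A m  E m        C m`
`     D m               B (m+1)`
`              A (m+1)  -E (m+1)  C (m+1)`
`                       …`

describes the same matrix. -/
noncomputable def staircase {k : ℕ} {p q : Fin k → ℕ} {a b : Fin (k + 1) → ℕ}
    (A : ∀ i : Fin k, Matrix (Fin (p i)) (Fin (a i.castSucc)) ℍ[ℝ])
    (B : ∀ i : Fin k, Matrix (Fin (b i.castSucc)) (Fin (q i)) ℍ[ℝ])
    (C : ∀ i : Fin k, Matrix (Fin (p i)) (Fin (a i.succ)) ℍ[ℝ])
    (D : ∀ i : Fin k, Matrix (Fin (b i.succ)) (Fin (q i)) ℍ[ℝ])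
    (E : ∀ i : Fin k, Matrix (Fin (p i)) (Fin (q i)) ℍ[ℝ])
    (m n : Fin k) (S T : Set (Fin (k + 1))) :
    Matrix ((Σ i : Set.Icc m n, Fin (p i)) ⊕ (Σ j : T, Fin (b j)))
      ((Σ i : Set.Icc m n, Fin (q i)) ⊕ (Σ j : S, Fin (a j))) ℍ[ℝ] :=
  Matrix.fromBlocks
    (Matrix.blockDiagonal' fun i : Set.Icc m n =>
      (-1 : ℍ[ℝ]) ^ ((i : Fin k).val - m.val) • E i)
    (chainAC A C m n S)
    (chainBD B D m n T)
    0

/-- The rank equality for the equations `m, …, n` in which the block bidiagonal matrix of the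
`A`'s and `C`'s has the block columns `S`, and that of the `B`'s and `D`'s the block rows `T`. -/
def RankEq {k : ℕ} {p q : Fin k → ℕ} {a b : Fin (k + 1) → ℕ}
    (A : ∀ i : Fin k, Matrix (Fin (p i)) (Fin (a i.castSucc)) ℍ[ℝ])
    (B : ∀ i : Fin k, Matrix (Fin (b i.castSucc)) (Fin (q i)) ℍ[ℝ])
    (C : ∀ i : Fin k, Matrix (Fin (p i)) (Fin (a i.succ)) ℍ[ℝ])
    (D : ∀ i : Fin k, Matrix (Fin (b i.succ)) (Fin (q i)) ℍ[ℝ])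
    (E : ∀ i : Fin k, Matrix (Fin (p i)) (Fin (q i)) ℍ[ℝ])
    (m n : Fin k) (S T : Set (Fin (k + 1))) : Prop :=
  rank (staircase A B C D E m n S T) = rank (chainAC A C m n S) + rank (chainBD B D m n T)

end Sylvester

/-!
A matrix equation is an equation of linear maps between right vector spaces. The unknowns are chosen
one at a time, and the equations left of `X j` restrict `X j` by a chain of linear relations it has
to select from: `step` turns a relation for `X i` into one for `X (i + 1)`, and along a chain of
relations a linear selection exists, by extending successively. Unfolding the relations, the system
is solvable if and only if `ChainCond` holds for all `m ≤ n` and both choices at either end. Up to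
alternating signs, `ChainCond` says that the image of the kernel of one bidiagonal matrix is
contained in the range of the other, which is what the staircase rank equality expresses.
-/

namespace Sylvester

section Selection

/-- A submodule `R` of `V × U` is regarded as a linear relation between `V` and `U`; the linear map
`X` selects `R` if `X w` is related to `w` whenever anything is. -/
def Selects {K V U : Type*} [Ring K] [AddCommGroup V] [Module K V] [AddCommGroup U] [Module K U]
    (X : V →ₗ[K] U) (R : Submodule K (V × U)) : Prop :=
  ∀ ⦃w u⦄, (w, u) ∈ R → (w, X w) ∈ R

variable {K V U : Type*} [DivisionRing K] [AddCommGroup V] [Module K V] [AddCommGroup U]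
  [Module K U]

theorem exists_selects (R : Submodule K (V × U)) : ∃ X : V →ₗ[K] U, Selects X R := by
  let π := LinearMap.fst K V U ∘ₗ R.subtype
  obtain ⟨σ, hσ⟩ := π.rangeRestrict.exists_rightInverse_of_surjective π.range_rangeRestrict
  obtain ⟨X, hX⟩ := (LinearMap.snd K V U ∘ₗ R.subtype ∘ₗ σ).exists_extend
  refine ⟨X, fun w u h => ?_⟩
  let w' : LinearMap.range π := ⟨w, ⟨(w, u), h⟩, rfl⟩
  have hfst : (σ w').1.1 = w := congrArg Subtype.val (LinearMap.congr_fun hσ w')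
  have hsnd : X w = (σ w').1.2 := LinearMap.congr_fun hX w'
  rw [hsnd, ← hfst]
  exact (σ w').2

theorem Selects.exists_eqOn {X₀ : V →ₗ[K] U} {R R₁ : Submodule K (V × U)} (hX₀ : Selects X₀ R)
    (hR : R ≤ R₁) :
    ∃ X, Selects X R₁ ∧ ∀ w u, (w, u) ∈ R → X w = X₀ w := by
  obtain ⟨Y, hY⟩ := exists_selects R₁
  let S := R.map (LinearMap.fst K V U)
  obtain ⟨π, hπ⟩ := S.subtype.exists_leftInverse_of_injective S.ker_subtype
  refine ⟨Y + (X₀ - Y) ∘ₗ S.subtype ∘ₗ π, fun w u h => ?_, fun w u h => ?_⟩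
  · obtain ⟨⟨x, y⟩, hxy, hx⟩ := (π w).2
    have hdiff : ((0 : V), X₀ x - Y x) ∈ R₁ := by
      simpa using sub_mem (hR (hX₀ hxy)) (hY (hR hxy))
    simpa [← show x = (π w : V) from hx] using add_mem (hY h) hdiff
  · have hw : π w = ⟨w, (w, u), h, rfl⟩ := LinearMap.congr_fun hπ ⟨w, (w, u), h, rfl⟩
    simp [hw]

theorem Selects.exists_forall_mem {R : Submodule K (V × U)} {l : List (Submodule K (V × U))}
    (hl : (R :: l).Pairwise (· ≤ ·)) {X₀ : V →ₗ[K] U} (hX₀ : Selects X₀ R) :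
    ∃ X, (∀ S ∈ l, Selects X S) ∧ ∀ w u, (w, u) ∈ R → X w = X₀ w := by
  induction l generalizing R X₀ with
  | nil => exact ⟨X₀, by simp⟩
  | cons R₁ l ih =>
    rw [List.pairwise_cons] at hl
    have hR : R ≤ R₁ := hl.1 R₁ List.mem_cons_self
    obtain ⟨X₁, hX₁, hX₁₀⟩ := hX₀.exists_eqOn hR
    obtain ⟨X, hX, hXX₁⟩ := ih hl.2 hX₁
    refine ⟨X, List.forall_mem_cons.2 ⟨fun w u h => ?_, hX⟩, fun w u h => ?_⟩
    · rw [hXX₁ w u h]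
      exact hX₁ h
    · rw [hXX₁ w u (hR h), hX₁₀ w u h]

theorem exists_forall_mem_selects {l : List (Submodule K (V × U))} (hl : l.Pairwise (· ≤ ·)) :
    ∃ X, ∀ R ∈ l, Selects X R := by
  have hbot : Selects 0 (⊥ : Submodule K (V × U)) := fun w u h => by
    simpa using (Prod.mk.inj h).1
  obtain ⟨X, hX, -⟩ := hbot.exists_forall_mem (List.pairwise_cons.2 ⟨fun _ _ => bot_le, hl⟩)
  exact ⟨X, hX⟩

theorem exists_selects_and_forall_mem_selects {l : List (Submodule K (V × U))}
    (hl : l.Pairwise (· ≤ ·)) (Γ : Submodule K (V × U))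
    (hΓ : ∀ R ∈ l, ∀ w u u', (w, u) ∈ Γ → (w, u') ∈ R → (w, u) ∈ R) :
    ∃ X, Selects X Γ ∧ ∀ R ∈ l, Selects X R := by
  have hchain : (Γ :: l.map (Γ ⊔ ·)).Pairwise (· ≤ ·) := by
    refine List.pairwise_cons.2 ⟨?_, hl.map _ fun _ _ h => sup_le_sup_left h Γ⟩
    simp
  obtain ⟨X, hX⟩ := exists_forall_mem_selects hchain
  rw [List.forall_mem_cons, List.forall_mem_map] at hX
  refine ⟨X, hX.1, fun R hR w u h => ?_⟩
  obtain ⟨⟨g, x⟩, hg, ⟨r, y⟩, hr, hgr⟩ :=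
    Submodule.mem_sup.1 (hX.2 R hR (Submodule.mem_sup_right h))
  obtain rfl : g + r = w := (Prod.mk.inj hgr).1
  have hgR : (g, u - y) ∈ R := by simpa using sub_mem h hr
  rw [← hgr]
  exact add_mem (hΓ R hR g x _ hg hgR) hr

end Selection

section Step

variable {K U U' V W W' P : Type*} [Ring K]
  [AddCommGroup U] [Module K U] [AddCommGroup U'] [Module K U'] [AddCommGroup V] [Module K V]
  [AddCommGroup W] [Module K W] [AddCommGroup W'] [Module K W'] [AddCommGroup P] [Module K P]
  (A : U →ₗ[K] P) (B : V →ₗ[K] W) (C : U' →ₗ[K] P) (D : V →ₗ[K] W') (E : V →ₗ[K] P)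

/-- The relation which a solution `Y` of `A ∘ X ∘ B + C ∘ Y ∘ D = E` has to select when `X` selects
`R`: it relates `D v` to every `u'` with `A u + C u' = E v` for some `u` related to `B v`. -/
def step (R : Submodule K (W × U)) : Submodule K (W' × U') where
  carrier := {x | ∃ v u, (B v, u) ∈ R ∧ D v = x.1 ∧ E v = A u + C x.2}
  zero_mem' := ⟨0, 0, by rw [map_zero]; exact R.zero_mem, by simp⟩
  add_mem' := by
    rintro x y ⟨v, u, hR, hD, hE⟩ ⟨v', u', hR', hD', hE'⟩
    refine ⟨v + v', u + u', by simpa using add_mem hR hR', by simp [hD, hD'], ?_⟩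
    simp only [map_add, hE, hE', Prod.snd_add]
    abel
  smul_mem' := by
    rintro c x ⟨v, u, hR, hD, hE⟩
    exact ⟨c • v, c • u, by simpa using R.smul_mem c hR, by simp [hD], by simp [hE]⟩

variable {A B C D E}

theorem mem_step {R : Submodule K (W × U)} {w : W'} {u' : U'} :
    (w, u') ∈ step A B C D E R ↔ ∃ v u, (B v, u) ∈ R ∧ D v = w ∧ E v = A u + C u' :=
  Iff.rfl

theorem step_mono : Monotone (step A B C D E) :=
  fun _ _ h _ ⟨v, u, hR, hx⟩ => ⟨v, u, h hR, hx⟩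

theorem exists_apply_eq_of_selects_step {R : Submodule K (W × U)} {Y : W' →ₗ[K] U'}
    (hY : Selects Y (step A B C D E R))
    (hD : ∀ v u, (B v, u) ∈ R → D v = 0 → ∃ u₁, (B v, u₁) ∈ R ∧ E v = A u₁)
    (hE : ∀ v u, (B v, u) ∈ R → ∃ u₁ u', (B v, u₁) ∈ R ∧ E v = A u₁ + C u')
    {v : V} {u : U} (hv : (B v, u) ∈ R) :
    ∃ u₁, (B v, u₁) ∈ R ∧ E v = A u₁ + C (Y (D v)) := by
  obtain ⟨u₁, u', hu₁, hEv⟩ := hE v u hv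
  obtain ⟨v₀, u₀, hv₀, hDv₀, hEv₀⟩ := mem_step.1 (hY (mem_step.2 ⟨v, u₁, hu₁, rfl, hEv⟩))
  obtain ⟨x, hx, hEx⟩ := hD (v - v₀) (u - u₀) (by simpa using sub_mem hv hv₀) (by simp [hDv₀])
  refine ⟨u₀ + x, by simpa using add_mem hv₀ hx, ?_⟩
  rw [← sub_add_cancel v v₀, map_add, hEx, hEv₀, map_add]
  simp only [sub_add_cancel]
  abel

end Step

section SelectsStep

variable {K U U' V W W' P : Type*} [DivisionRing K]
  [AddCommGroup U] [Module K U] [AddCommGroup U'] [Module K U'] [AddCommGroup V] [Module K V]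
  [AddCommGroup W] [Module K W] [AddCommGroup W'] [Module K W'] [AddCommGroup P] [Module K P]
  {A : U →ₗ[K] P} {B : V →ₗ[K] W} {C : U' →ₗ[K] P} {D : V →ₗ[K] W'} {E : V →ₗ[K] P}

theorem exists_selects_of_selects_step {l : List (Submodule K (W × U))}
    (hl : l.Pairwise (· ≤ ·)) (hbot : ⊥ ∈ l) (htop : ⊤ ∈ l)
    {Y : W' →ₗ[K] U'} (hY : ∀ R ∈ l, Selects Y (step A B C D E R))
    (hD : ∀ R ∈ l, ∀ v u, (B v, u) ∈ R → D v = 0 → ∃ u₁, (B v, u₁) ∈ R ∧ E v = A u₁)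
    (hE : ∀ R ∈ l, ∀ v u, (B v, u) ∈ R → ∃ u₁ u', (B v, u₁) ∈ R ∧ E v = A u₁ + C u') :
    ∃ X : W →ₗ[K] U, (∀ R ∈ l, Selects X R) ∧ A ∘ₗ X ∘ₗ B + C ∘ₗ Y ∘ₗ D = E := by
  -- It suffices to choose `f = X ∘ B`, subject to `A ∘ f + C ∘ Y ∘ D = E` and to the selections.
  let S (R : Submodule K (W × U)) : Submodule K (V × U) :=
    R.comap (B.prodMap .id) ⊓
      (E ∘ₗ .fst K V U).eqLocus (A ∘ₗ .snd K V U + C ∘ₗ Y ∘ₗ D ∘ₗ .fst K V U)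
  have hS : Monotone S := fun R R' h => inf_le_inf_right _ (Submodule.comap_mono h)
  obtain ⟨f, hf⟩ := exists_forall_mem_selects (hl.map S fun _ _ h => hS h)
  rw [List.forall_mem_map] at hf
  have hfS {R} (hR : R ∈ l) {v u} (hv : (B v, u) ∈ R) :
      (B v, f v) ∈ R ∧ E v = A (f v) + C (Y (D v)) := by
    obtain ⟨u₁, hu₁⟩ := exists_apply_eq_of_selects_step (hY R hR) (hD R hR) (hE R hR) hv
    exact hf R hR (show (v, u₁) ∈ S R from hu₁)
  obtain ⟨X, hXf, hX⟩ := exists_selects_and_forall_mem_selects hl (LinearMap.range (B.prod f)) <| by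
    rintro R hR _ _ u ⟨v, hv⟩ hu
    obtain ⟨rfl, rfl⟩ := Prod.mk.inj hv
    exact (hfS hR hu).1
  have hXB (v : V) : X (B v) = f v := by
    obtain ⟨v', hv'⟩ := hXf ⟨v, rfl⟩
    obtain ⟨hB, hfX⟩ := Prod.mk.inj hv'
    have hker : (B (v' - v), f (v' - v)) ∈ (⊥ : Submodule K (W × U)) :=
      (hfS hbot (u := 0) (by simpa [sub_eq_zero] using hB)).1
    rw [← hfX, ← sub_eq_zero, ← map_sub]
    exact (Prod.mk.inj hker).2
  refine ⟨X, hX, LinearMap.ext fun v => ?_⟩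
  simp [hXB, ← (hfS htop (v := v) (u := 0) trivial).2]

end SelectsStep

section System

variable {K : Type*} [Ring K] {k : ℕ} {P Q : Fin k → Type*} {U W : Fin (k + 1) → Type*}
  [∀ i, AddCommGroup (P i)] [∀ i, Module K (P i)] [∀ i, AddCommGroup (Q i)] [∀ i, Module K (Q i)]
  [∀ j, AddCommGroup (U j)] [∀ j, Module K (U j)] [∀ j, AddCommGroup (W j)] [∀ j, Module K (W j)]
  (A : ∀ i, U i.castSucc →ₗ[K] P i) (B : ∀ i, Q i →ₗ[K] W i.castSucc)
  (C : ∀ i, U i.succ →ₗ[K] P i) (D : ∀ i, Q i →ₗ[K] W i.succ) (E : ∀ i, Q i →ₗ[K] P i)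

/-- The relations which `X j` has to select in a solution `X` of the system, ordered by inclusion:
those enforced by the equations before `j`, and the trivial ones. -/
def flags : ∀ j : Fin (k + 1), List (Submodule K (W j × U j)) :=
  Fin.induction [⊥, ⊤] fun i l => ⊥ :: (l.map (step (A i) (B i) (C i) (D i) (E i)) ++ [⊤])

theorem flags_zero : flags A B C D E 0 = [⊥, ⊤] := rfl

theorem flags_succ (i : Fin k) :
    flags A B C D E i.succ =
      ⊥ :: ((flags A B C D E i.castSucc).map (step (A i) (B i) (C i) (D i) (E i)) ++ [⊤]) :=
  Fin.induction_succ ..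

theorem bot_mem_flags (j : Fin (k + 1)) : ⊥ ∈ flags A B C D E j := by
  cases j using Fin.cases <;> simp [flags_zero, flags_succ]

theorem top_mem_flags (j : Fin (k + 1)) : ⊤ ∈ flags A B C D E j := by
  cases j using Fin.cases <;> simp [flags_zero, flags_succ]

theorem pairwise_flags (j : Fin (k + 1)) : (flags A B C D E j).Pairwise (· ≤ ·) := by
  induction j using Fin.induction with
  | zero => simp [flags_zero]
  | succ i ih =>
    simpa [flags_succ, List.pairwise_append] using ih.map _ fun _ _ h => step_mono h

/-- `Linked s j e w u` says that `(w, u)` is the last term of a sequence `(w s, u s), …, (w j, u j)`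
whose successive terms are connected by the equations between `s` and `j`; if `e` holds, the first
term is required to be zero. -/
def Linked (s j : Fin (k + 1)) (e : Prop) (w : W j) (u : U j) : Prop :=
  ∃ (v : ∀ i, Q i) (w' : ∀ j, W j) (u' : ∀ j, U j),
    (∀ i, s ≤ i.castSucc → i.castSucc < j →
      B i (v i) = w' i.castSucc ∧ D i (v i) = w' i.succ ∧
        E i (v i) = A i (u' i.castSucc) + C i (u' i.succ)) ∧
    (e → w' s = 0 ∧ u' s = 0) ∧ w' j = w ∧ u' j = u

variable {A B C D E}

theorem linked_self {j : Fin (k + 1)} {e : Prop} {w : W j} {u : U j} :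
    Linked A B C D E j j e w u ↔ (e → w = 0 ∧ u = 0) := by
  constructor
  · rintro ⟨v, w', u', -, he, rfl, rfl⟩
    exact he
  · intro he
    exact ⟨0, Pi.single j w, Pi.single j u, fun i h h' => absurd h h'.not_ge, by simpa using he,
      by simp, by simp⟩

theorem linked_succ {s : Fin (k + 1)} {i : Fin k} (hs : s ≤ i.castSucc) {e : Prop} {w : W i.succ}
    {u : U i.succ} :
    Linked A B C D E s i.succ e w u ↔
      ∃ v u₀, Linked A B C D E s i.castSucc e (B i v) u₀ ∧ D i v = w ∧
        E i v = A i u₀ + C i u := by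
  constructor
  · rintro ⟨v, w', u', h, he, rfl, rfl⟩
    obtain ⟨hB, hD, hE⟩ := h i hs i.castSucc_lt_succ
    refine ⟨v i, u' i.castSucc, ⟨v, w', u', fun i' h₁ h₂ => h i' h₁ ?_, he, hB.symm, rfl⟩, hD, hE⟩
    exact h₂.trans i.castSucc_lt_succ
  · rintro ⟨x, _, ⟨v, w', u', h, he, hB, rfl⟩, rfl, hE⟩
    have hsi : s ≠ i.succ := (hs.trans_lt i.castSucc_lt_succ).ne
    refine ⟨Function.update v i x, Function.update w' i.succ (D i x), Function.update u' i.succ u,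
      fun i' h₁ h₂ => ?_, by simpa [hsi] using he, by simp, by simp⟩
    obtain rfl | hi : i' = i ∨ i'.castSucc < i.castSucc := by grind
    · simp [(i'.castSucc_lt_succ).ne, hB, hE]
    · have hne : i' ≠ i := by rintro rfl; exact hi.false
      have hne' : i'.castSucc ≠ i.succ := (hi.trans i.castSucc_lt_succ).ne
      simpa [hne, hne'] using h i' h₁ hi

theorem exists_linked_of_mem_flags {j : Fin (k + 1)} {R : Submodule K (W j × U j)}
    (hR : R ∈ flags A B C D E j) :
    ∃ s ≤ j, ∃ e : Prop, ∀ w u, (w, u) ∈ R ↔ Linked A B C D E s j e w u := by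
  have hbot (j) : ∃ s ≤ j, ∃ e : Prop, ∀ w u,
      (w, u) ∈ (⊥ : Submodule K (W j × U j)) ↔ Linked A B C D E s j e w u :=
    ⟨j, le_rfl, True, fun w u => by simp [linked_self]⟩
  have htop (j) : ∃ s ≤ j, ∃ e : Prop, ∀ w u,
      (w, u) ∈ (⊤ : Submodule K (W j × U j)) ↔ Linked A B C D E s j e w u :=
    ⟨j, le_rfl, False, fun w u => by simp [linked_self]⟩
  induction j using Fin.induction with
  | zero =>
    rw [flags_zero, List.mem_pair] at hR
    obtain rfl | rfl := hR
    exacts [hbot 0, htop 0]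
  | succ i ih =>
    simp only [flags_succ, List.mem_cons, List.mem_append, List.mem_map, List.not_mem_nil,
      or_false] at hR
    obtain rfl | ⟨R, hR, rfl⟩ | rfl := hR
    · exact hbot _
    · obtain ⟨s, hs, e, hRs⟩ := ih hR
      refine ⟨s, hs.trans i.castSucc_lt_succ.le, e, fun w u => ?_⟩
      simp only [mem_step, linked_succ hs, hRs]
    · exact htop _

variable (A B C D E) in
/-- The linear form of the rank equalities: whenever vectors `v i` satisfy
`B (i + 1) (v (i + 1)) = D i (v i)` for `m ≤ i < n`, the vectors `E i (v i)` can be written as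
`A i (u i) + C i (u (i + 1))`. If `e` holds, one restricts to `B m (v m) = 0` and `u m = 0`; if
`e'` holds, to `D n (v n) = 0` and `u (n + 1) = 0`. The `w j` are the common values of
`B j (v j)` and `D (j - 1) (v (j - 1))`. -/
def ChainCond (m n : Fin k) (e e' : Prop) : Prop :=
  ∀ (v : ∀ i, Q i) (w : ∀ j, W j),
    (∀ i ∈ Set.Icc m n, B i (v i) = w i.castSucc ∧ D i (v i) = w i.succ) →
    (e → w m.castSucc = 0) → (e' → w n.succ = 0) →
    ∃ u : ∀ j, U j, (e → u m.castSucc = 0) ∧ (e' → u n.succ = 0) ∧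
      ∀ i ∈ Set.Icc m n, E i (v i) = A i (u i.castSucc) + C i (u i.succ)

theorem chainCond_of_solution {X : ∀ j, W j →ₗ[K] U j}
    (hX : ∀ i, A i ∘ₗ X i.castSucc ∘ₗ B i + C i ∘ₗ X i.succ ∘ₗ D i = E i) (m n : Fin k)
    (e e' : Prop) : ChainCond A B C D E m n e e' := by
  intro v w hv he he'
  refine ⟨fun j => X j (w j), fun h => by simp [he h], fun h => by simp [he' h], fun i hi => ?_⟩
  obtain ⟨hB, hD⟩ := hv i hi
  simp [← hX i, hB, hD]

theorem chainCond_self_iff (i : Fin k) (e e' : Prop) :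
    ChainCond A B C D E i i e e' ↔ ∀ v, (e → B i v = 0) → (e' → D i v = 0) →
      ∃ x y, (e → x = 0) ∧ (e' → y = 0) ∧ E i v = A i x + C i y := by
  have hne : i.castSucc ≠ i.succ := i.castSucc_lt_succ.ne
  simp only [ChainCond, Set.Icc_self, Set.mem_singleton_iff, forall_eq]
  constructor
  · intro h v hB hD
    obtain ⟨u, hu⟩ := h (Pi.single i v)
      (Function.update (Pi.single i.castSucc (B i v)) i.succ (D i v)) (by simp [hne])
      (by simpa [hne] using hB) (by simpa using hD)
    exact ⟨u i.castSucc, u i.succ, by simpa using hu⟩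
  · intro h v w hv he he'
    obtain ⟨x, y, hxy⟩ := h (v i) (by simpa [hv] using he) (by simpa [hv] using he')
    exact ⟨Function.update (Pi.single i.castSucc x) i.succ y, by simpa [hne] using hxy⟩

theorem ChainCond.exists_linked {m n : Fin k} (hmn : m ≤ n) {e e' : Prop}
    (h : ChainCond A B C D E m n e e') {v : Q n} {u : U n.castSucc}
    (hv : Linked A B C D E m.castSucc n.castSucc e (B n v) u) (he' : e' → D n v = 0) :
    ∃ u₁ u', Linked A B C D E m.castSucc n.castSucc e (B n v) u₁ ∧ (e' → u' = 0) ∧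
      E n v = A n u₁ + C n u' := by
  obtain ⟨v', w', u₀, hv', he, hB, -⟩ := hv
  have hlt {i} (hi : i < n) : i ≠ n ∧ i.castSucc ≠ n.succ :=
    ⟨hi.ne, (i.castSucc_lt_castSucc_iff.2 hi |>.trans n.castSucc_lt_succ).ne⟩
  let v₁ := Function.update v' n v
  let w₁ := Function.update w' n.succ (D n v)
  have hvw : ∀ i ∈ Set.Icc m n, B i (v₁ i) = w₁ i.castSucc ∧ D i (v₁ i) = w₁ i.succ := by
    intro i hi
    obtain rfl | hin := hi.2.eq_or_lt
    · simp [v₁, w₁, (i.castSucc_lt_succ).ne, hB]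
    · obtain ⟨hBi, hDi, -⟩ := hv' i hi.1 hin
      simp [v₁, w₁, hlt hin, hBi, hDi]
  have hwm (he₁ : e) : w₁ m.castSucc = 0 := by
    have hne : m.castSucc ≠ n.succ := (Fin.castSucc_lt_succ_iff.2 hmn).ne
    simpa [w₁, hne] using (he he₁).1
  obtain ⟨u', hum, hun, hu'⟩ := h v₁ w₁ hvw hwm (by simpa [w₁] using he')
  refine ⟨u' n.castSucc, u' n.succ,
    ⟨v', w', u', fun i h₁ h₂ => ?_, fun he₁ => ⟨(he he₁).1, hum he₁⟩, hB, rfl⟩, hun,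
    by simpa [v₁] using hu' n ⟨hmn, le_rfl⟩⟩
  obtain ⟨hBi, hDi, -⟩ := hv' i h₁ h₂
  exact ⟨hBi, hDi, by simpa [v₁, hlt h₂] using hu' i ⟨h₁, h₂.le⟩⟩

end System

section Solvability

variable {K : Type*} [DivisionRing K] {k : ℕ} {P Q : Fin k → Type*} {U W : Fin (k + 1) → Type*}
  [∀ i, AddCommGroup (P i)] [∀ i, Module K (P i)] [∀ i, AddCommGroup (Q i)] [∀ i, Module K (Q i)]
  [∀ j, AddCommGroup (U j)] [∀ j, Module K (U j)] [∀ j, AddCommGroup (W j)] [∀ j, Module K (W j)]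
  {A : ∀ i, U i.castSucc →ₗ[K] P i} {B : ∀ i, Q i →ₗ[K] W i.castSucc}
  {C : ∀ i, U i.succ →ₗ[K] P i} {D : ∀ i, Q i →ₗ[K] W i.succ} {E : ∀ i, Q i →ₗ[K] P i}

theorem exists_solution_of_chainCond
    (h : ∀ m n, m ≤ n → ∀ e e', ChainCond A B C D E m n e e') :
    ∃ X : ∀ j, W j →ₗ[K] U j,
      ∀ i, A i ∘ₗ X i.castSucc ∘ₗ B i + C i ∘ₗ X i.succ ∘ₗ D i = E i := by
  suffices hj : ∀ j (Y : W j →ₗ[K] U j), (∀ R ∈ flags A B C D E j, Selects Y R) →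
      ∃ X : ∀ j, W j →ₗ[K] U j, X j = Y ∧ ∀ i, i.castSucc < j →
        A i ∘ₗ X i.castSucc ∘ₗ B i + C i ∘ₗ X i.succ ∘ₗ D i = E i by
    obtain ⟨Y, hY⟩ := exists_forall_mem_selects (pairwise_flags A B C D E (Fin.last k))
    obtain ⟨X, -, hX⟩ := hj _ Y hY
    exact ⟨X, fun i => hX i i.castSucc_lt_last⟩
  intro j
  induction j using Fin.induction with
  | zero => exact fun Y _ => ⟨Pi.single 0 Y, by simp, fun i hi => absurd hi (Fin.not_lt_zero _)⟩
  | succ n ih =>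
    intro Y hY
    have hext {e' : Prop} {R} (hR : R ∈ flags A B C D E n.castSucc) {v u} (hv : (B n v, u) ∈ R)
        (he' : e' → D n v = 0) :
        ∃ u₁ u', (B n v, u₁) ∈ R ∧ (e' → u' = 0) ∧ E n v = A n u₁ + C n u' := by
      obtain ⟨s, hs, e, hRs⟩ := exists_linked_of_mem_flags hR
      obtain ⟨m, rfl⟩ := Fin.exists_castSucc_eq.2 (hs.trans_lt n.castSucc_lt_last).ne
      simp only [hRs] at hv ⊢
      exact (h m n hs e e').exists_linked (Fin.castSucc_le_castSucc_iff.1 hs) hv he'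
    obtain ⟨Z, hZ, hZY⟩ := exists_selects_of_selects_step (pairwise_flags A B C D E n.castSucc)
      (bot_mem_flags ..) (top_mem_flags ..) (E := E n) (fun R hR => hY _ (by
        simpa [flags_succ] using .inr (.inl ⟨R, hR, rfl⟩)))
      (fun R hR v u hv hD => by simpa using hext (e' := True) hR hv fun _ => hD)
      (fun R hR v u hv => by simpa using hext (e' := False) hR hv False.elim)
    obtain ⟨X, rfl, hX⟩ := ih Z hZ
    refine ⟨Function.update X n.succ Y, by simp, fun i hi => ?_⟩
    obtain rfl | hi : i = n ∨ i.castSucc < n.castSucc := by grind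
    · simpa [(i.castSucc_lt_succ).ne] using hZY
    · have hne : i ≠ n := by rintro rfl; exact hi.false
      have hne' : i.castSucc ≠ n.succ := (hi.trans n.castSucc_lt_succ).ne
      simpa [hne, hne'] using hX i hi

end Solvability

open Matrix

section Rank

variable {R : Type*} {l m n o : Type*}

/-- The rank of a matrix over a possibly noncommutative ring, as the dimension of its column space
for scalar multiplication from the right. -/
noncomputable def rightRank [Semiring R] (M : Matrix m n R) : ℕ :=
  Module.finrank Rᵐᵒᵖ (Submodule.span Rᵐᵒᵖ (Set.range M.col))

/-- The action of a matrix on column vectors, as a linear map for scalar multiplication from the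
right. -/
abbrev rightLin [Semiring R] [Fintype n] (M : Matrix m n R) : (n → R) →ₗ[Rᵐᵒᵖ] (m → R) :=
  mulVecBilin R Rᵐᵒᵖ M

theorem rightLin_mul [Semiring R] [Fintype n] [Fintype o] (M : Matrix m n R) (N : Matrix n o R) :
    rightLin (M * N) = rightLin M ∘ₗ rightLin N :=
  LinearMap.ext fun v => (M.mulVec_mulVec v N).symm

theorem rightLin_add [Semiring R] [Fintype n] (M N : Matrix m n R) :
    rightLin (M + N) = rightLin M + rightLin N :=
  map_add _ M N

theorem rightLin_bijective [Semiring R] [Fintype n] :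
    Function.Bijective (rightLin : Matrix m n R → (n → R) →ₗ[Rᵐᵒᵖ] (m → R)) := by
  classical
  refine ⟨fun M N h => Matrix.ext_of_mulVec_single fun i => LinearMap.congr_fun h _, fun f => ?_⟩
  refine ⟨Matrix.of fun i j => f (Pi.single j 1) i, LinearMap.pi_ext fun j x => ?_⟩
  have hx : Pi.single j x = MulOpposite.op x • (Pi.single j 1 : n → R) := by
    rw [← Pi.single_smul, op_smul_eq_mul, one_mul]
  rw [hx, map_smul, map_smul, mulVecBilin_apply, mulVec_single_one]
  rfl

theorem rightRank_eq_finrank_range [Semiring R] [Fintype n] (M : Matrix m n R) :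
    rightRank M = Module.finrank Rᵐᵒᵖ (rightLin M).range := by
  classical
  suffices h : Submodule.span Rᵐᵒᵖ (Set.range M.col) = (rightLin M).range by rw [rightRank, h]
  refine le_antisymm (Submodule.span_le.2 ?_) ?_
  · rintro _ ⟨j, rfl⟩
    exact ⟨Pi.single j 1, M.mulVec_single_one j⟩
  · rintro _ ⟨v, rfl⟩
    rw [mulVecBilin_apply, mulVec_eq_sum]
    exact sum_mem fun j _ => Submodule.smul_mem _ _ (Submodule.subset_span ⟨j, rfl⟩)

theorem rightRank_submatrix_equiv [Semiring R] (M : Matrix m n R) (e : l ≃ m) (f : o ≃ n) :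
    rightRank (M.submatrix e f) = rightRank M := by
  let φ := LinearEquiv.funCongrLeft Rᵐᵒᵖ R e
  have hcol : Set.range (M.submatrix e f).col = φ '' Set.range M.col := by
    rw [← Set.range_comp, ← f.surjective.range_comp]
    rfl
  rw [rightRank, hcol, ← LinearEquiv.coe_toLinearMap, Submodule.span_image]
  exact φ.finrank_map_eq _

instance finite_mulOpposite [Semiring R] : Module.Finite Rᵐᵒᵖ R :=
  .of_surjective (LinearMap.toSpanSingleton Rᵐᵒᵖ R 1) fun x => ⟨MulOpposite.op x, one_mul x⟩

section LinearMap

variable {K Q U V W : Type*} [DivisionRing K] [AddCommGroup Q] [Module K Q] [AddCommGroup U]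
  [Module K U] [AddCommGroup V] [Module K V] [AddCommGroup W] [Module K W]

theorem finrank_eq_finrank_map_snd_add_finrank_comap_inl [FiniteDimensional K V]
    [FiniteDimensional K W] (S : Submodule K (V × W)) :
    Module.finrank K S = Module.finrank K (S.map (.snd K V W)) +
      Module.finrank K (S.comap (.inl K V W)) := by
  have hker : ((LinearMap.snd K V W).domRestrict S).ker.map S.subtype =
      (S.comap (.inl K V W)).map (.inl K V W) := by
    rw [LinearMap.ker_domRestrict, Submodule.map_comap_subtype, Submodule.map_comap_eq,
      LinearMap.ker_snd, inf_comm]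
  rw [← ((LinearMap.snd K V W).domRestrict S).finrank_range_add_finrank_ker,
    LinearMap.range_domRestrict, ← Submodule.finrank_map_subtype_eq, hker,
    (Submodule.equivMapOfInjective (.inl K V W) LinearMap.inl_injective _).finrank_eq]

theorem finrank_range_coprod_prod_eq_iff [FiniteDimensional K V] [FiniteDimensional K W]
    (E : Q →ₗ[K] V) (M : U →ₗ[K] V) (N : Q →ₗ[K] W) :
    Module.finrank K ((E.coprod M).prod (N ∘ₗ .fst K Q U)).range =
        Module.finrank K M.range + Module.finrank K N.range ↔
      ∀ v, N v = 0 → ∃ u, E v = M u := by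
  set F := (E.coprod M).prod (N ∘ₗ .fst K Q U)
  have hle : M.range ≤ F.range.comap (.inl K V W) := by
    rintro _ ⟨u, rfl⟩
    exact ⟨(0, u), by simp [F]⟩
  rw [finrank_eq_finrank_map_snd_add_finrank_comap_inl, add_comm, ← LinearMap.range_comp,
    LinearMap.snd_prod, LinearMap.range_comp_of_range_eq_top _ Submodule.range_fst,
    Nat.add_right_cancel_iff]
  constructor
  · intro h v hv
    have hmem : E v ∈ F.range.comap (.inl K V W) := ⟨(v, 0), by simp [F, hv]⟩
    rw [← Submodule.eq_of_le_of_finrank_eq hle h.symm] at hmem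
    obtain ⟨u, hu⟩ := hmem
    exact ⟨u, hu.symm⟩
  · intro h
    suffices hge : F.range.comap (.inl K V W) ≤ M.range by rw [hge.antisymm hle]
    rintro x ⟨⟨v, u⟩, hvu⟩
    obtain ⟨hEM, hN⟩ := Prod.mk.inj hvu
    obtain ⟨u', hu'⟩ := h v hN
    exact ⟨u' + u, by rw [map_add, ← hu']; exact hEM⟩

theorem finrank_sup_eq_left_iff [FiniteDimensional K V] (S T : Submodule K V) :
    Module.finrank K ↑(S ⊔ T) = Module.finrank K S ↔ T ≤ S :=
  ⟨fun h => sup_eq_left.1 (Submodule.eq_of_le_of_finrank_eq le_sup_left h.symm).symm,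
    fun h => by rw [sup_eq_left.2 h]⟩

theorem finrank_inf_eq_left_iff [FiniteDimensional K V] (S T : Submodule K V) :
    Module.finrank K ↑(S ⊓ T) = Module.finrank K S ↔ S ≤ T :=
  ⟨fun h => inf_eq_left.1 (Submodule.eq_of_le_of_finrank_eq inf_le_left h),
    fun h => by rw [inf_eq_left.2 h]⟩

end LinearMap

variable [DivisionRing R] [Fintype l] [Fintype n]

theorem rightRank_fromBlocks_zero₂₂_eq_iff [Finite m] [Finite o] (E : Matrix m n R)
    (M : Matrix m l R) (N : Matrix o n R) :
    rightRank (fromBlocks E M N 0) = rightRank M + rightRank N ↔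
      ∀ v, N *ᵥ v = 0 → ∃ u, E *ᵥ v = M *ᵥ u := by
  let F := ((rightLin E).coprod (rightLin M)).prod (rightLin N ∘ₗ .fst Rᵐᵒᵖ (n → R) (l → R))
  let φ := LinearEquiv.sumArrowLequivProdArrow n l Rᵐᵒᵖ R
  let ψ := LinearEquiv.sumArrowLequivProdArrow m o Rᵐᵒᵖ R
  have hF : F ∘ₗ φ.toLinearMap = ψ.toLinearMap ∘ₗ rightLin (fromBlocks E M N 0) := by
    ext1 v
    simp only [LinearMap.comp_apply, mulVecBilin_apply, fromBlocks_mulVec, zero_mulVec, add_zero]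
    rfl
  rw [rightRank_eq_finrank_range, rightRank_eq_finrank_range, rightRank_eq_finrank_range,
    ← ψ.finrank_map_eq, ← LinearMap.range_comp, ← hF,
    LinearMap.range_comp_of_range_eq_top _ φ.range, finrank_range_coprod_prod_eq_iff]
  rfl

theorem rightRank_fromBlocks_zero₂₁_eq_iff [Finite m] [Finite o] (A : Matrix m l R)
    (E : Matrix m n R) (D : Matrix o n R) :
    rightRank (fromBlocks A E 0 D) = rightRank A + rightRank D ↔
      ∀ v, D *ᵥ v = 0 → ∃ x, E *ᵥ v = A *ᵥ x := by
  have hswap : fromBlocks A E 0 D =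
      (fromBlocks E A D 0).submatrix (Equiv.refl _) (Equiv.sumComm l n) :=
    (fromBlocks_submatrix_sum_swap_right ..).symm
  rw [hswap, rightRank_submatrix_equiv, rightRank_fromBlocks_zero₂₂_eq_iff]

theorem rightRank_fromBlocks_zero₁₂_eq_iff [Finite m] [Finite o] (B : Matrix o n R)
    (E : Matrix m n R) (C : Matrix m l R) :
    rightRank (fromBlocks B 0 E C) = rightRank B + rightRank C ↔
      ∀ v, B *ᵥ v = 0 → ∃ y, E *ᵥ v = C *ᵥ y := by
  have hswap : fromBlocks B 0 E C =
      (fromBlocks E C B 0).submatrix (Equiv.sumComm o m) (Equiv.refl _) :=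
    (fromBlocks_submatrix_sum_swap_left ..).symm
  rw [hswap, rightRank_submatrix_equiv, add_comm, rightRank_fromBlocks_zero₂₂_eq_iff]

theorem range_rightLin_fromCols (M : Matrix m n R) (N : Matrix m l R) :
    (rightLin (fromCols M N)).range = (rightLin M).range ⊔ (rightLin N).range := by
  rw [← LinearMap.range_coprod, ← LinearMap.range_comp_of_range_eq_top _
    (LinearEquiv.sumArrowLequivProdArrow n l Rᵐᵒᵖ R).range]
  exact congrArg LinearMap.range (LinearMap.ext fun v => M.fromCols_mulVec N v)

theorem rightRank_fromCols_eq_iff [Fintype o] [Finite m] (A : Matrix m l R) (E : Matrix m n R)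
    (C : Matrix m o R) :
    rightRank (fromCols (fromCols A E) C) = rightRank (fromCols A C) ↔
      ∀ v, ∃ x y, E *ᵥ v = A *ᵥ x + C *ᵥ y := by
  rw [rightRank_eq_finrank_range, rightRank_eq_finrank_range, range_rightLin_fromCols,
    range_rightLin_fromCols, range_rightLin_fromCols, sup_right_comm, finrank_sup_eq_left_iff]
  simp [SetLike.le_def, Submodule.mem_sup, eq_comm]

theorem ker_rightLin_fromRows (M : Matrix m n R) (N : Matrix o n R) :
    (rightLin (fromRows M N)).ker = (rightLin M).ker ⊓ (rightLin N).ker := by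
  ext v
  simp [fromRows_mulVec, funext_iff]

theorem rightRank_eq_iff_finrank_ker_eq (M : Matrix m n R) (N : Matrix o n R) :
    rightRank M = rightRank N ↔
      Module.finrank Rᵐᵒᵖ (rightLin M).ker = Module.finrank Rᵐᵒᵖ (rightLin N).ker := by
  have hM := (rightLin M).finrank_range_add_finrank_ker
  have hN := (rightLin N).finrank_range_add_finrank_ker
  rw [rightRank_eq_finrank_range, rightRank_eq_finrank_range]
  lia

theorem rightRank_fromRows_eq_iff {l : Type*} (B : Matrix o n R) (E : Matrix m n R)
    (D : Matrix l n R) :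
    rightRank (fromRows (fromRows B E) D) = rightRank (fromRows B D) ↔
      ∀ v, B *ᵥ v = 0 → D *ᵥ v = 0 → E *ᵥ v = 0 := by
  rw [rightRank_eq_iff_finrank_ker_eq, ker_rightLin_fromRows, ker_rightLin_fromRows,
    ker_rightLin_fromRows, inf_right_comm, finrank_inf_eq_left_iff]
  simp [SetLike.le_def]

end Rank

section SignedChain

variable {k : ℕ}

/-- The indices of the unknowns which occur in the equations `m, …, n`, without the first one if `e`
holds and without the last one if `e'` holds. -/
def window (m n : Fin k) (e e' : Prop) : Set (Fin (k + 1)) :=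
  {j ∈ Set.Icc m.castSucc n.succ | (e → j ≠ m.castSucc) ∧ (e' → j ≠ n.succ)}

theorem window_false_false (m n : Fin k) :
    window m n False False = Set.Icc m.castSucc n.succ := by
  ext j
  simp [window]

theorem window_true_true (m n : Fin k) : window m n True True = Set.Ioo m.castSucc n.succ := by
  ext j
  simp only [window, Set.mem_ofPred_eq, Set.mem_Icc, Set.mem_Ioo]
  grind

theorem window_false_true (m n : Fin k) : window m n False True = Set.Ico m.castSucc n.succ := by
  ext j
  simp only [window, Set.mem_ofPred_eq, Set.mem_Icc, Set.mem_Ico]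
  grind

theorem window_true_false (m n : Fin k) : window m n True False = Set.Ioc m.castSucc n.succ := by
  ext j
  simp only [window, Set.mem_ofPred_eq, Set.mem_Icc, Set.mem_Ioc]
  grind

theorem sum_single_apply_self {ι κ : Type*} [Fintype ι] [DecidableEq κ] {M : κ → Type*}
    [∀ j, AddCommMonoid (M j)] {f : ι → κ} (hf : Function.Injective f) (x : ∀ i, M (f i)) (i : ι) :
    (∑ i', Pi.single (f i') (x i') : ∀ j, M j) (f i) = x i := by
  rw [Finset.sum_apply, Fintype.sum_eq_single i fun i' h => Pi.single_eq_of_ne (hf.ne h.symm) _,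
    Pi.single_eq_same]

theorem sum_single_apply_of_notMem_range {ι κ : Type*} [Fintype ι] [DecidableEq κ] {M : κ → Type*}
    [∀ j, AddCommMonoid (M j)] {f : ι → κ} (x : ∀ i, M (f i)) {j : κ} (hj : j ∉ Set.range f) :
    (∑ i, Pi.single (f i) (x i) : ∀ j, M j) j = 0 := by
  rw [Finset.sum_apply]
  exact Finset.sum_eq_zero fun i _ => Pi.single_eq_of_ne (fun h => hj ⟨i, h.symm⟩) _

/-- The family whose entry at `j` is the sum of the vectors `x i` with `i.castSucc = j` and `y i`
with `i.succ = j`; there is at most one of each. -/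
def overlap {W : Fin (k + 1) → Type*} [∀ j, AddCommMonoid (W j)] {m n : Fin k}
    (x : ∀ i : Set.Icc m n, W i.1.castSucc) (y : ∀ i : Set.Icc m n, W i.1.succ) : ∀ j, W j :=
  ∑ i : Set.Icc m n, Pi.single i.1.castSucc (x i) + ∑ i : Set.Icc m n, Pi.single i.1.succ (y i)

theorem neg_one_pow_smul_eq_iff {M : Type*} [AddCommGroup M] (r : ℕ) {x y : M} :
    (-1 : ℤ) ^ r • x = y ↔ x = (-1 : ℤ) ^ r • y := by
  obtain h | h := neg_one_pow_eq_or ℤ r <;> simp [h, neg_eq_iff_eq_neg]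

theorem neg_one_pow_succ_sub {m i : Fin k} (h : m ≤ i) :
    (-1 : ℤ) ^ (i.succ.val - m.val) = -(-1) ^ (i.val - m.val) := by
  rw [Fin.val_succ, Nat.succ_sub h, pow_succ, mul_neg_one]

theorem exists_signed_eq_of_forall_mem_window {W : Fin (k + 1) → Type*} [∀ j, AddCommGroup (W j)]
    {m n : Fin k} (hmn : m ≤ n) {e e' : Prop} {β δ : ∀ j, W j} (hβ : β n.succ = 0)
    (hδ : δ m.castSucc = 0) (h : ∀ j ∈ window m n (¬ e) (¬ e'), β j + δ j = 0) :
    ∃ w : ∀ j, W j, (∀ i ∈ Set.Icc m n, (-1 : ℤ) ^ (i.val - m.val) • β i.castSucc = w i.castSucc ∧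
      (-1 : ℤ) ^ (i.val - m.val) • δ i.succ = w i.succ) ∧
      (e → w m.castSucc = 0) ∧ (e' → w n.succ = 0) := by
  have hlt : m.castSucc < n.succ := Fin.castSucc_lt_succ_iff.2 hmn
  refine ⟨fun j => (-1 : ℤ) ^ (j.val - m.val) • if j = n.succ then -δ j else β j,
    fun i hi => ⟨?_, ?_⟩, fun he => ?_, fun he' => ?_⟩
  · simp only [(Fin.castSucc_lt_succ_iff.2 hi.2).ne, if_false, Fin.val_castSucc]
  · dsimp only
    rw [neg_one_pow_succ_sub hi.1]
    split_ifs with hin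
    · rw [smul_neg, neg_smul, neg_neg]
    · have hβδ : β i.succ = -δ i.succ := by
        refine eq_neg_of_add_eq_zero_left (h _ ⟨⟨?_, ?_⟩, fun _ => ?_, fun _ => hin⟩)
        all_goals grind
      rw [hβδ, smul_neg, neg_smul, neg_neg]
  · have hm := h m.castSucc ⟨⟨le_rfl, hlt.le⟩, fun h => absurd he h, fun _ => hlt.ne⟩
    simpa [hlt.ne, hδ] using hm
  · have hn := h n.succ ⟨⟨hlt.le, le_rfl⟩, fun _ => hlt.ne', fun h => absurd he' h⟩
    simp only [if_true, eq_neg_of_add_eq_zero_right hn, hβ, neg_zero, smul_zero]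

theorem forall_mem_window_add_eq_zero {W : Fin (k + 1) → Type*} [∀ j, AddCommGroup (W j)]
    {m n : Fin k} (hmn : m ≤ n) {e e' : Prop} {β δ w : ∀ j, W j} (hβ : β n.succ = 0)
    (hδ : δ m.castSucc = 0)
    (hw : ∀ i ∈ Set.Icc m n, (-1 : ℤ) ^ (i.val - m.val) • β i.castSucc = w i.castSucc ∧
      (-1 : ℤ) ^ (i.val - m.val) • δ i.succ = w i.succ)
    (he : e → w m.castSucc = 0) (he' : e' → w n.succ = 0) :
    ∀ j ∈ window m n (¬ e) (¬ e'), β j + δ j = 0 := by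
  rintro j ⟨⟨hmj, hjn⟩, hem, hen⟩
  have hβw (hj : j ≠ n.succ) : β j = (-1 : ℤ) ^ (j.val - m.val) • w j := by
    obtain ⟨i, rfl⟩ := Fin.exists_castSucc_eq.2 (hjn.lt_of_ne hj |>.trans_le (Fin.le_last _)).ne
    exact (neg_one_pow_smul_eq_iff _).1 (hw i (by grind)).1
  have hδw (hj : j ≠ m.castSucc) : δ j = -((-1 : ℤ) ^ (j.val - m.val) • w j) := by
    obtain ⟨i, rfl⟩ := Fin.exists_succ_eq.2 ((Fin.zero_le _).trans_lt (hmj.lt_of_ne' hj)).ne'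
    have hi : i ∈ Set.Icc m n := by grind
    rw [(neg_one_pow_smul_eq_iff _).1 (hw i hi).2, neg_one_pow_succ_sub hi.1, neg_smul,
      neg_neg]
  by_cases hm : j = m.castSucc
  · subst hm
    rw [hδ, add_zero, hβw (Fin.castSucc_lt_succ_iff.2 hmn).ne, he (by_contra fun h => hem h rfl),
      smul_zero]
  by_cases hn : j = n.succ
  · subst hn
    rw [hβ, zero_add, hδw hm, he' (by_contra fun h => hen h rfl), smul_zero, neg_zero]
  · rw [hβw hn, hδw hm, add_neg_cancel]

end SignedChain

section SignedChainCond

variable {K : Type*} [Ring K] {k : ℕ} {P Q : Fin k → Type*} {U W : Fin (k + 1) → Type*}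
  [∀ i, AddCommGroup (P i)] [∀ i, Module K (P i)] [∀ i, AddCommGroup (Q i)] [∀ i, Module K (Q i)]
  [∀ j, AddCommGroup (U j)] [∀ j, Module K (U j)] [∀ j, AddCommGroup (W j)] [∀ j, Module K (W j)]
  (A : ∀ i, U i.castSucc →ₗ[K] P i) (B : ∀ i, Q i →ₗ[K] W i.castSucc)
  (C : ∀ i, U i.succ →ₗ[K] P i) (D : ∀ i, Q i →ₗ[K] W i.succ) (E : ∀ i, Q i →ₗ[K] P i)

/-- The form of `ChainCond` read off from the staircase matrices: in the block row `j`, the vectors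
`B i (v i)` with `j = i.castSucc` and `D i (v i)` with `j = i.succ` now cancel instead of being
equal, at the price of signs in front of the `E i`. -/
def SignedChainCond (m n : Fin k) (S T : Set (Fin (k + 1))) : Prop :=
  ∀ v : ∀ i : Set.Icc m n, Q i,
    (∀ j ∈ T, overlap (fun i => B i (v i)) (fun i => D i (v i)) j = 0) →
    ∃ u : ∀ j, U j, (∀ j ∉ S, u j = 0) ∧ ∀ i : Set.Icc m n,
      (-1 : ℤ) ^ (i.1.val - m.val) • E i (v i) = A i (u i.1.castSucc) + C i (u i.1.succ)

variable {A B C D E}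

theorem eqOn_piecewise_window {m n : Fin k} {e e' : Prop} [DecidablePred (· ∈ window m n e e')]
    {u : ∀ j, U j} (hm : e → u m.castSucc = 0) (hn : e' → u n.succ = 0) {j : Fin (k + 1)}
    (hj : j ∈ Set.Icc m.castSucc n.succ) : (window m n e e').piecewise u 0 j = u j := by
  by_cases hjw : j ∈ window m n e e'
  · exact Set.piecewise_eq_of_mem _ _ _ hjw
  rw [Set.piecewise_eq_of_notMem _ _ _ hjw]
  obtain ⟨he, rfl⟩ | ⟨he', rfl⟩ : (e ∧ j = m.castSucc) ∨ (e' ∧ j = n.succ) := by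
    by_contra! h
    exact hjw ⟨hj, h⟩
  exacts [(hm he).symm, (hn he').symm]

theorem chainCond_iff_signedChainCond {m n : Fin k} (hmn : m ≤ n) (e e' : Prop) :
    ChainCond A B C D E m n e e' ↔
      SignedChainCond A B C D E m n (window m n e e') (window m n (¬ e) (¬ e')) := by
  classical
  let β (v : ∀ i : Set.Icc m n, Q i) : ∀ j, W j :=
    ∑ i : Set.Icc m n, Pi.single i.1.castSucc (B i (v i))
  let δ (v : ∀ i : Set.Icc m n, Q i) : ∀ j, W j :=
    ∑ i : Set.Icc m n, Pi.single i.1.succ (D i (v i))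
  have hβ (v) (i : Set.Icc m n) : β v i.1.castSucc = B i (v i) := sum_single_apply_self
    (f := fun i : Set.Icc m n => i.1.castSucc)
    ((Fin.castSucc_injective k).comp Subtype.val_injective) _ i
  have hδ (v) (i : Set.Icc m n) : δ v i.1.succ = D i (v i) := sum_single_apply_self
    (f := fun i : Set.Icc m n => i.1.succ) ((Fin.succ_injective k).comp Subtype.val_injective) _ i
  have hβn (v) : β v n.succ = 0 := sum_single_apply_of_notMem_range _ (by grind)
  have hδm (v) : δ v m.castSucc = 0 := sum_single_apply_of_notMem_range _ (by grind)
  constructor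
  · intro h v hv
    obtain ⟨w, hw, he, he'⟩ := exists_signed_eq_of_forall_mem_window hmn (hβn v) (hδm v) hv
    let v' (i : Fin k) : Q i :=
      if hi : i ∈ Set.Icc m n then (-1 : ℤ) ^ (i.val - m.val) • v ⟨i, hi⟩ else 0
    obtain ⟨u, hum, hun, hu⟩ := h v' w (fun i hi => by
      have hβi := hβ v ⟨i, hi⟩
      have hδi := hδ v ⟨i, hi⟩
      simpa only [v', dif_pos hi, map_zsmul, ← hβi, ← hδi] using hw i hi) he he'
    refine ⟨(window m n e e').piecewise u 0, fun j hj => Set.piecewise_eq_of_notMem _ _ _ hj,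
      fun ⟨i, hi⟩ => ?_⟩
    rw [eqOn_piecewise_window hum hun (by grind), eqOn_piecewise_window hum hun (by grind),
      ← hu i hi]
    simp only [v', dif_pos hi, map_zsmul]
  · intro h v w hv he he'
    let v' (i : Set.Icc m n) : Q i := (-1 : ℤ) ^ (i.1.val - m.val) • v i
    obtain ⟨u, hu, huE⟩ := h v' (forall_mem_window_add_eq_zero hmn (hβn v') (hδm v') (w := w)
      (fun i hi => by
        have hβi := hβ v' ⟨i, hi⟩
        have hδi := hδ v' ⟨i, hi⟩
        simp only [v', map_zsmul] at hβi hδi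
        rw [neg_one_pow_smul_eq_iff, neg_one_pow_smul_eq_iff, ← (hv i hi).1, ← (hv i hi).2]
        exact ⟨hβi, hδi⟩) he he')
    refine ⟨u, fun h => hu _ fun hm => hm.2.1 h rfl, fun h => hu _ fun hn => hn.2.2 h rfl,
      fun i hi => ?_⟩
    rw [← huE ⟨i, hi⟩, eq_comm, neg_one_pow_smul_eq_iff, map_zsmul]

end SignedChainCond

section Staircase

variable {R : Type*} {k : ℕ} {p q : Fin k → ℕ} {a b : Fin (k + 1) → ℕ}

/-- The block bidiagonal matrix with block rows `i ∈ [m, n]` and block columns `j ∈ S`, whose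
nonzero blocks are `A i` in block column `i.castSucc` and `C i` in block column `i.succ`. -/
def bidiagonal [Zero R] (A : ∀ i : Fin k, Matrix (Fin (p i)) (Fin (a i.castSucc)) R)
    (C : ∀ i : Fin k, Matrix (Fin (p i)) (Fin (a i.succ)) R) (m n : Fin k) (S : Set (Fin (k + 1))) :
    Matrix (Σ i : Set.Icc m n, Fin (p i)) (Σ j : S, Fin (a j)) R :=
  of fun x y =>
    if h : (y.1 : Fin (k + 1)) = (x.1 : Fin k).castSucc then
      A x.1 x.2 (Fin.cast (congrArg a h) y.2)
    else if h : (y.1 : Fin (k + 1)) = (x.1 : Fin k).succ then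
      C x.1 x.2 (Fin.cast (congrArg a h) y.2)
    else 0

variable (A : ∀ i : Fin k, Matrix (Fin (p i)) (Fin (a i.castSucc)) R)
  (B : ∀ i : Fin k, Matrix (Fin (b i.castSucc)) (Fin (q i)) R)
  (C : ∀ i : Fin k, Matrix (Fin (p i)) (Fin (a i.succ)) R)
  (D : ∀ i : Fin k, Matrix (Fin (b i.succ)) (Fin (q i)) R)
  (E : ∀ i : Fin k, Matrix (Fin (p i)) (Fin (q i)) R)

theorem bidiagonal_mulVec [NonUnitalNonAssocSemiring R] (m n : Fin k) (S : Set (Fin (k + 1)))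
    [Fintype S] {u : ∀ j, Fin (a j) → R} (hu : ∀ j ∉ S, u j = 0)
    (x : Σ i : Set.Icc m n, Fin (p i)) :
    (bidiagonal A C m n S *ᵥ fun y => u y.1 y.2) x =
      (A x.1 *ᵥ u x.1.1.castSucc + C x.1 *ᵥ u x.1.1.succ) x.2 := by
  obtain ⟨⟨i, hi⟩, x⟩ := x
  have hne : i.castSucc ≠ i.succ := i.castSucc_lt_succ.ne
  let f (j : Fin (k + 1)) : R := ∑ y : Fin (a j),
    (if h : j = i.castSucc then A i x (Fin.cast (congrArg a h) y)
      else if h : j = i.succ then C i x (Fin.cast (congrArg a h) y) else 0) * u j y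
  calc
    _ = ∑ j : S, f j := Fintype.sum_sigma _
    _ = ∑ j, f j := Fintype.sum_of_injective Subtype.val Subtype.val_injective _ _
      (fun j hj => by simp [f, hu j (by simpa using hj)]) fun _ => rfl
    _ = f i.castSucc + f i.succ := Fintype.sum_eq_add _ _ hne fun j hj => by simp [f, hj]
    _ = _ := by simp [f, hne.symm, mulVec, dotProduct]

theorem transpose_bidiagonal_mulVec [NonUnitalNonAssocSemiring R] (m n : Fin k)
    (T : Set (Fin (k + 1))) (v : ∀ i : Set.Icc m n, Fin (q i) → R) (y : Σ j : T, Fin (b j)) :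
    ((bidiagonal (fun i => (B i)ᵀ) (fun i => (D i)ᵀ) m n T)ᵀ *ᵥ fun x => v x.1 x.2) y =
      overlap (W := fun j => Fin (b j) → R) (fun i => B i *ᵥ v i) (fun i => D i *ᵥ v i)
        y.1 y.2 := by
  obtain ⟨⟨j, hj⟩, y⟩ := y
  rw [mulVec, dotProduct, Fintype.sum_sigma, overlap]
  simp only [Pi.add_apply, Finset.sum_apply, ← Finset.sum_add_distrib]
  refine Finset.sum_congr rfl fun i _ => ?_
  obtain rfl | hc := eq_or_ne j i.1.castSucc
  · simp [bidiagonal, (i.1.castSucc_lt_succ).ne, mulVec, dotProduct]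
  obtain rfl | hs := eq_or_ne j i.1.succ
  · simp [bidiagonal, hc, mulVec, dotProduct]
  · simp [bidiagonal, hc, hs]

theorem blockDiagonal'_mulVec {o : Type*} [Fintype o] [DecidableEq o] {l r : o → Type*}
    [∀ i, Fintype (r i)] [NonUnitalNonAssocSemiring R] (M : ∀ i, Matrix (l i) (r i) R)
    (v : ∀ i, r i → R) (x : Σ i, l i) :
    (blockDiagonal' M *ᵥ fun y => v y.1 y.2) x = (M x.1 *ᵥ v x.1) x.2 := by
  obtain ⟨i, x⟩ := x
  rw [mulVec, dotProduct, Fintype.sum_sigma, Fintype.sum_eq_single i]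
  · simp [mulVec, dotProduct, blockDiagonal'_apply]
  · intro i' h
    simp [blockDiagonal'_apply, h.symm]

theorem neg_one_pow_smul_mulVec {l r : Type*} [Fintype r] [Ring R] (s : ℕ) (M : Matrix l r R)
    (v : r → R) :
    ((-1 : R) ^ s • M) *ᵥ v = (-1 : ℤ) ^ s • M *ᵥ v := by
  obtain h | h := Nat.even_or_odd s <;> simp [h.neg_one_pow, neg_mulVec]

/-- The matrix of the rank equality for the equations `m, …, n`, with its block rows and block
columns sorted by kind. -/
def staircaseMatrix [Ring R] (m n : Fin k) (S T : Set (Fin (k + 1))) :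
    Matrix ((Σ i : Set.Icc m n, Fin (p i)) ⊕ (Σ j : T, Fin (b j)))
      ((Σ i : Set.Icc m n, Fin (q i)) ⊕ (Σ j : S, Fin (a j))) R :=
  fromBlocks (blockDiagonal' fun i : Set.Icc m n => (-1 : R) ^ (i.1.val - m.val) • E i)
    (bidiagonal A C m n S) (bidiagonal (fun i => (B i)ᵀ) (fun i => (D i)ᵀ) m n T)ᵀ 0

/-- The rank equality for the equations `m, …, n`: the rank of the staircase matrix is the sum of
the ranks of its two bidiagonal parts. -/
def StaircaseRankEq [Ring R] (m n : Fin k) (S T : Set (Fin (k + 1))) : Prop :=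
  rightRank (staircaseMatrix A B C D E m n S T) = rightRank (bidiagonal A C m n S) +
    rightRank (bidiagonal (fun i => (B i)ᵀ) (fun i => (D i)ᵀ) m n T)ᵀ

theorem exists_eq_zero_off_and_eq [Zero R] (S : Set (Fin (k + 1)))
    (u₀ : (Σ j : S, Fin (a j)) → R) :
    ∃ u : ∀ j, Fin (a j) → R, (∀ j ∉ S, u j = 0) ∧ (fun y => u y.1 y.2) = u₀ := by
  classical
  refine ⟨fun j y => if h : j ∈ S then u₀ ⟨⟨j, h⟩, y⟩ else 0, fun j hj => ?_, ?_⟩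
  · simp only [hj, dif_neg, not_false_eq_true]
    rfl
  · funext ⟨⟨j, hj⟩, y⟩
    exact dif_pos hj

variable [DivisionRing R]

theorem staircaseRankEq_iff_signedChainCond (m n : Fin k) (S T : Set (Fin (k + 1))) :
    StaircaseRankEq A B C D E m n S T ↔
      SignedChainCond (U := fun j => Fin (a j) → R) (W := fun j => Fin (b j) → R)
        (fun i => rightLin (A i)) (fun i => rightLin (B i))
        (fun i => rightLin (C i)) (fun i => rightLin (D i)) (fun i => rightLin (E i)) m n S T := by
  classical
  have hBD (v : ∀ i : Set.Icc m n, Fin (q i) → R) :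
      (bidiagonal (fun i => (B i)ᵀ) (fun i => (D i)ᵀ) m n T)ᵀ *ᵥ (fun x => v x.1 x.2) = 0 ↔
        ∀ j ∈ T, overlap (W := fun j => Fin (b j) → R) (fun i => B i *ᵥ v i)
          (fun i => D i *ᵥ v i) j = 0 := by
    simp only [funext_iff, transpose_bidiagonal_mulVec, Sigma.forall, Subtype.forall]
    rfl
  have hEAC (v : ∀ i : Set.Icc m n, Fin (q i) → R) {u : ∀ j, Fin (a j) → R}
      (hu : ∀ j ∉ S, u j = 0) :
      (blockDiagonal' fun i : Set.Icc m n => (-1 : R) ^ (i.1.val - m.val) • E i) *ᵥ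
          (fun x => v x.1 x.2) = bidiagonal A C m n S *ᵥ (fun y => u y.1 y.2) ↔
        ∀ i : Set.Icc m n, (-1 : ℤ) ^ (i.1.val - m.val) • E i *ᵥ v i =
          A i *ᵥ u i.1.castSucc + C i *ᵥ u i.1.succ := by
    simp only [funext_iff, blockDiagonal'_mulVec, bidiagonal_mulVec A C m n S hu,
      neg_one_pow_smul_mulVec, Sigma.forall]
  rw [StaircaseRankEq, staircaseMatrix, rightRank_fromBlocks_zero₂₂_eq_iff]
  constructor
  · intro h v hv
    obtain ⟨u₀, hu₀⟩ := h (fun x => v x.1 x.2) ((hBD v).2 hv)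
    obtain ⟨u, hu, rfl⟩ := exists_eq_zero_off_and_eq S u₀
    exact ⟨u, hu, (hEAC v hu).1 hu₀⟩
  · intro h v hv
    obtain ⟨u, hu, huE⟩ := h (fun i x => v ⟨i, x⟩) ((hBD _).1 hv)
    exact ⟨_, (hEAC _ hu).2 huE⟩

theorem exists_solution_iff_chainCond :
    (∃ X : ∀ j : Fin (k + 1), Matrix (Fin (a j)) (Fin (b j)) R,
        ∀ i, A i * X i.castSucc * B i + C i * X i.succ * D i = E i) ↔
      ∀ m n, m ≤ n → ∀ e e', ChainCond (U := fun j => Fin (a j) → R) (W := fun j => Fin (b j) → R)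
        (fun i => rightLin (A i)) (fun i => rightLin (B i))
        (fun i => rightLin (C i)) (fun i => rightLin (D i)) (fun i => rightLin (E i)) m n e e' := by
  have heq (X : ∀ j, Matrix (Fin (a j)) (Fin (b j)) R) (i : Fin k) :
      A i * X i.castSucc * B i + C i * X i.succ * D i = E i ↔
        rightLin (A i) ∘ₗ rightLin (X i.castSucc) ∘ₗ rightLin (B i) +
          rightLin (C i) ∘ₗ rightLin (X i.succ) ∘ₗ rightLin (D i) = rightLin (E i) := by
    rw [← rightLin_bijective.injective.eq_iff, Matrix.mul_assoc, Matrix.mul_assoc, rightLin_add,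
      rightLin_mul, rightLin_mul, rightLin_mul, rightLin_mul]
  constructor
  · rintro ⟨X, hX⟩ m n - e e'
    exact chainCond_of_solution (X := fun j => rightLin (X j)) (fun i => (heq X i).1 (hX i)) m n
      e e'
  · intro h
    obtain ⟨X, hX⟩ := exists_solution_of_chainCond h
    choose Y hY using fun j => rightLin_bijective.surjective (X j)
    refine ⟨Y, fun i => (heq Y i).2 ?_⟩
    rw [hY, hY, hX]

theorem staircaseRankEq_iff_chainCond {m n : Fin k} (hmn : m ≤ n) (e e' : Prop) :
    StaircaseRankEq A B C D E m n (window m n e e') (window m n (¬ e) (¬ e')) ↔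
      ChainCond (U := fun j => Fin (a j) → R) (W := fun j => Fin (b j) → R)
        (fun i => rightLin (A i)) (fun i => rightLin (B i))
        (fun i => rightLin (C i)) (fun i => rightLin (D i)) (fun i => rightLin (E i)) m n e e' := by
  rw [staircaseRankEq_iff_signedChainCond, chainCond_iff_signedChainCond hmn]

end Staircase

theorem forall_le_iff_forall_self_and_forall_lt {α : Type*} [PartialOrder α] {p : α → α → Prop} :
    (∀ m n, m ≤ n → p m n) ↔ (∀ i, p i i) ∧ ∀ m n, m < n → p m n :=
  ⟨fun h => ⟨fun i => h i i le_rfl, fun m n hmn => h m n hmn.le⟩,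
    fun h m n hmn => hmn.lt_or_eq.elim (h.2 m n) fun hmn => hmn ▸ h.1 m⟩

end Sylvester

open Sylvester in
theorem theorem2p1_general {R : Type*} [DivisionRing R] {k : ℕ} {p q : Fin k → ℕ}
    {a b : Fin (k + 1) → ℕ}
    (A : ∀ i : Fin k, Matrix (Fin (p i)) (Fin (a i.castSucc)) R)
    (B : ∀ i : Fin k, Matrix (Fin (b i.castSucc)) (Fin (q i)) R)
    (C : ∀ i : Fin k, Matrix (Fin (p i)) (Fin (a i.succ)) R)
    (D : ∀ i : Fin k, Matrix (Fin (b i.succ)) (Fin (q i)) R)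
    (E : ∀ i : Fin k, Matrix (Fin (p i)) (Fin (q i)) R) :
    (∃ X : ∀ j : Fin (k + 1), Matrix (Fin (a j)) (Fin (b j)) R,
        ∀ i, A i * X i.castSucc * B i + C i * X i.succ * D i = E i) ↔
      (∀ i : Fin k,
        rightRank (Matrix.fromCols (Matrix.fromCols (A i) (E i)) (C i)) =
            rightRank (Matrix.fromCols (A i) (C i)) ∧
        rightRank (Matrix.fromRows (Matrix.fromRows (B i) (E i)) (D i)) =
            rightRank (Matrix.fromRows (B i) (D i)) ∧
        rightRank (Matrix.fromBlocks (A i) (E i) 0 (D i)) =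
            rightRank (A i) + rightRank (D i) ∧
        rightRank (Matrix.fromBlocks (B i) 0 (E i) (C i)) =
            rightRank (B i) + rightRank (C i)) ∧
      (∀ m n : Fin k, m < n →
        StaircaseRankEq A B C D E m n
          (Set.Icc m.castSucc n.succ) (Set.Ioo m.castSucc n.succ) ∧
        StaircaseRankEq A B C D E m n
          (Set.Ioo m.castSucc n.succ) (Set.Icc m.castSucc n.succ) ∧
        StaircaseRankEq A B C D E m n
          (Set.Ico m.castSucc n.succ) (Set.Ioc m.castSucc n.succ) ∧
        StaircaseRankEq A B C D E m n
          (Set.Ioc m.castSucc n.succ) (Set.Ico m.castSucc n.succ)) := by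
  rw [exists_solution_iff_chainCond, forall_le_iff_forall_self_and_forall_lt]
  refine and_congr (forall_congr' fun i => ?_) (forall₃_congr fun m n hmn => ?_)
  · rw [rightRank_fromCols_eq_iff, rightRank_fromRows_eq_iff, rightRank_fromBlocks_zero₂₁_eq_iff,
      rightRank_fromBlocks_zero₁₂_eq_iff]
    simp only [Prop.forall, chainCond_self_iff, Matrix.mulVecBilin_apply, true_imp_iff,
      false_imp_iff, true_and, exists_and_left, exists_eq_left, Matrix.mulVec_zero, add_zero,
      zero_add]
    tauto
  · have hcond (e e') := staircaseRankEq_iff_chainCond A B C D E hmn.le e e'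
    simp only [Prop.forall, ← hcond, not_true, not_false_eq_true, window_false_false,
      window_true_true, window_false_true, window_true_false]
    tauto

-- The last four families, in order, use the chains
--   `A m, C m, …, A n, C n`          and `D m, B (m+1), …, D (n-1), B n`;
--   `C m, A (m+1), …, C (n-1), A n`  and `B m, D m, …, B n, D n`;
--   `A m, C m, …, C (n-1), A n`      and `D m, B (m+1), …, B n, D n`;
--   `C m, A (m+1), …, A n, C n`      and `B m, D m, …, D (n-1), B n`.
theorem theorem2p1 {k : ℕ} {p q : Fin k → ℕ} {a b : Fin (k + 1) → ℕ}
    (A : ∀ i : Fin k, Matrix (Fin (p i)) (Fin (a i.castSucc)) ℍ[ℝ])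
    (B : ∀ i : Fin k, Matrix (Fin (b i.castSucc)) (Fin (q i)) ℍ[ℝ])
    (C : ∀ i : Fin k, Matrix (Fin (p i)) (Fin (a i.succ)) ℍ[ℝ])
    (D : ∀ i : Fin k, Matrix (Fin (b i.succ)) (Fin (q i)) ℍ[ℝ])
    (E : ∀ i : Fin k, Matrix (Fin (p i)) (Fin (q i)) ℍ[ℝ]) :
    (∃ X : ∀ j : Fin (k + 1), Matrix (Fin (a j)) (Fin (b j)) ℍ[ℝ],
        Sylvester.IsSolution A B C D E X) ↔
      (∀ i : Fin k,
        Sylvester.rank (Matrix.fromCols (Matrix.fromCols (A i) (E i)) (C i)) =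
            Sylvester.rank (Matrix.fromCols (A i) (C i)) ∧
        Sylvester.rank (Matrix.fromRows (Matrix.fromRows (B i) (E i)) (D i)) =
            Sylvester.rank (Matrix.fromRows (B i) (D i)) ∧
        Sylvester.rank (Matrix.fromBlocks (A i) (E i) 0 (D i)) =
            Sylvester.rank (A i) + Sylvester.rank (D i) ∧
        Sylvester.rank (Matrix.fromBlocks (B i) 0 (E i) (C i)) =
            Sylvester.rank (B i) + Sylvester.rank (C i)) ∧
      (∀ m n : Fin k, m < n →
        Sylvester.RankEq A B C D E m n
          (Set.Icc m.castSucc n.succ) (Set.Ioo m.castSucc n.succ) ∧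
        Sylvester.RankEq A B C D E m n
          (Set.Ioo m.castSucc n.succ) (Set.Icc m.castSucc n.succ) ∧
        Sylvester.RankEq A B C D E m n
          (Set.Ico m.castSucc n.succ) (Set.Ioc m.castSucc n.succ) ∧
        Sylvester.RankEq A B C D E m n
          (Set.Ioc m.castSucc n.succ) (Set.Ico m.castSucc n.succ)) :=
  theorem2p1_general A B C D E
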